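/- Let $G=(V,E)$ be a finite Eulerian plane triangulation: a finite connected graph embedded in the plane (multiple edges allowed, no loops) such that every face, including the outer one, is bounded by a triangle and every vertex has even degree. Let $V=V_1\cup V_2\cup V_3$ be a partition of the vertices into the classes of a proper 3-colouring, let $E=E_{12}\cup E_{13}\cup E_{23}$ be the corresponding partition of the edges ($E_{ij}$ being the edges that join $V_i$ to $V_j$), and suppose that every vertex of $V_3$ has degree $4$ or $6$. For $J\in\mathbb R$ let $$Z_{\rm HMBW}(G;J)=\sum_{\sigma\in\{\pm1\}^{V}}\exp\Big(J\sum_{t}\sigma_a\sigma_b\sigma_c\Big),$$ where $t$ runs over all the faces of $G$ and $a,b,c$ are the three vertices of $t$. For a plane graph $H=(W,A)$ with plane dual $H^*=(W^*,A^*)$, where $e^*=\langle a^*b^*\rangle\in A^*$ denotes the dual edge that crosses $e=\langle ab\rangle\in A$, let $$Z_{\rm mAT}(H,H^*;K_2,K_2',K_4)=\sum_{\sigma\in\{\pm1\}^{W}}\ \sum_{\tau\in\{\pm1\}^{W^*}}\exp\Big(\sum_{e=\langle ab\rangle\in A}\big[K_2\,\sigma_a\sigma_b+K_2'\,\tau_{a^*}\tau_{b^*}+K_4\,\sigma_a\sigma_b\,\tau_{a^*}\tau_{b^*}\big]\Big).$$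 Then the embedded subgraph $G_{13}$ formed by the edges $E_{13}$ and their endpoints is a connected plane graph with vertex set $V_1\cup V_3$. Its dual is $G_{13}^*=(V_2,E_{13}^*)$: the faces of $G_{13}$ correspond bijectively to the vertices in $V_2$, and the dual of an edge $e\in E_{13}$ joins the two vertices of $V_2$ opposite to $e$ in the two triangles of $G$ that contain $e$. Moreover, for every $J\in\mathbb R$, $$Z_{\rm HMBW}(G;J)=Z_{\rm mAT}(G_{13},G_{13}^*;J,0,J).$$ The same holds with the indices $1$ and $2$ interchanged, that is, for $G_{23}=(V_2\cup V_3,E_{23})$ and $G_{23}^*=(V_1,E_{23}^*)$. -/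

import Mathlib

/-- A finite graph embedded in a closed oriented surface (loops and multiple edges allowed, no
isolated vertices), as a combinatorial map on a type `D` of darts (oriented edges). `rot d` is the
next dart after `d` around the tail of `d`, in a fixed sense of rotation, and `inv d` is the
dart `d` with its orientation reversed. -/
structure CombMap (D : Type*) where
  rot : Equiv.Perm D
  inv : Equiv.Perm D
  inv_inv : ∀ d, inv (inv d) = d
  inv_ne : ∀ d, inv d ≠ d

namespace CombMap

variable {D : Type*}

/-- `facePerm d` is the dart that follows `d` on the boundary of the face incident to `d`. -/
def facePerm (M : CombMap D) : Equiv.Perm D := M.rot * M.inv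

/-- Vertices are the orbits of `rot`. -/
def Vertex (M : CombMap D) : Type _ := Quotient (Equiv.Perm.SameCycle.setoid M.rot)

/-- Edges are the orbits of `inv`, that is, the pairs `{d, inv d}`. -/
def Edge (M : CombMap D) : Type _ := Quotient (Equiv.Perm.SameCycle.setoid M.inv)

/-- Faces are the orbits of `facePerm`. -/
def Face (M : CombMap D) : Type _ := Quotient (Equiv.Perm.SameCycle.setoid M.facePerm)

/-- The tail of a dart. -/
def vert (M : CombMap D) (d : D) : M.Vertex := Quotient.mk _ d

/-- The edge underlying a dart. -/
def edge (M : CombMap D) (d : D) : M.Edge := Quotient.mk _ d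

/-- The face whose boundary walk contains the dart. -/
def face (M : CombMap D) (d : D) : M.Face := Quotient.mk _ d

/-- The dual map: its vertices are the faces of `M`. The dart `d` of the dual crosses the dart `d`
of `M`; it joins the face of `d` to the face of `inv d`, the two faces that meet at the edge. -/
def dual (M : CombMap D) : CombMap D where
  rot := M.facePerm
  inv := M.inv
  inv_inv := M.inv_inv
  inv_ne := M.inv_ne

/-- The bijection `e ↦ e*` between the edges of a map and those of its dual. -/
def dualEdge (M : CombMap D) : M.Edge ≃ M.dual.Edge := Equiv.refl _

section Finite

variable [Fintype D]

noncomputable instance (M : CombMap D) : Fintype M.Vertex :=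
  have : Finite M.Vertex := Quotient.finite _
  Fintype.ofFinite _

noncomputable instance (M : CombMap D) : Fintype M.Edge :=
  have : Finite M.Edge := Quotient.finite _
  Fintype.ofFinite _

noncomputable instance (M : CombMap D) : Fintype M.Face :=
  have : Finite M.Face := Quotient.finite _
  Fintype.ofFinite _

noncomputable instance (M : CombMap D) : DecidableEq M.Vertex := Classical.decEq _

noncomputable instance (M : CombMap D) : DecidableEq M.Edge := Classical.decEq _

noncomputable instance (M : CombMap D) : DecidableEq M.Face := Classical.decEq _

/-- The map is connected: any dart is carried to any other by the group generated by `rot`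
and `inv`. -/
def IsConnected (M : CombMap D) : Prop :=
  ∀ d d' : D, ∃ g ∈ Subgroup.closure {M.rot, M.inv}, g d = d'

/-- A (connected) plane graph: a connected map on the sphere, that is, of Euler
characteristic two. The outer face counts as a face. -/
def IsPlane (M : CombMap D) : Prop :=
  M.IsConnected ∧
    (Fintype.card M.Vertex : ℤ) - Fintype.card M.Edge + Fintype.card M.Face = 2

/-- Every face is bounded by a triangle: its boundary walk has three darts, and consecutive (hence
all three) vertices on it are distinct. -/
def IsTriangulation (M : CombMap D) : Prop :=
  ∀ d, M.facePerm (M.facePerm (M.facePerm d)) = d ∧ M.vert d ≠ M.vert (M.facePerm d)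

/-- The number of darts with tail `v`. -/
noncomputable def degree (M : CombMap D) (v : M.Vertex) : ℕ :=
  (Finset.univ.filter fun d => M.vert d = v).card

/-- Every vertex has even degree. -/
def IsEulerian (M : CombMap D) : Prop := ∀ v, Even (M.degree v)

end Finite

/-- The endpoints of every edge have different colours. -/
def IsProperColoring (M : CombMap D) {α : Type*} (c : M.Vertex → α) : Prop :=
  ∀ d, c (M.vert d) ≠ c (M.vert (M.inv d))

section Restrict

variable [Fintype D]

theorem exists_return (f : Equiv.Perm D) (S : Finset D) (d : S) :
    ∃ n : ℕ, (f ^ (n + 1)) (d : D) ∈ S := by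
  refine ⟨orderOf f - 1, ?_⟩
  rw [Nat.sub_add_cancel (orderOf_pos f), pow_orderOf_eq_one]
  exact d.2

open Classical in
/-- The first point of `S` among `f d, f (f d), …`. -/
noncomputable def firstReturn (f : Equiv.Perm D) (S : Finset D) (d : S) : S :=
  ⟨(f ^ (Nat.find (exists_return f S d) + 1)) (d : D), Nat.find_spec (exists_return f S d)⟩

theorem firstReturn_injective (f : Equiv.Perm D) (S : Finset D) :
    Function.Injective (firstReturn f S) := by
  classical
  have key : ∀ (a b : S) (m n : ℕ), m < n → (f ^ (m + 1)) (a : D) = (f ^ (n + 1)) (b : D) →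
      (f ^ (n - m - 1 + 1)) (b : D) ∈ S := by
    intro a b m n hmn h
    have h1 : n + 1 = (m + 1) + (n - m - 1 + 1) := by omega
    rw [h1, pow_add f (m + 1) (n - m - 1 + 1), Equiv.Perm.mul_apply] at h
    rw [← (f ^ (m + 1)).injective h]
    exact a.2
  intro a b h
  have h' : (f ^ (Nat.find (exists_return f S a) + 1)) (a : D) =
      (f ^ (Nat.find (exists_return f S b) + 1)) (b : D) := congrArg Subtype.val h
  rcases lt_trichotomy (Nat.find (exists_return f S a)) (Nat.find (exists_return f S b)) with
    hl | he | hg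
  · exact absurd (key a b _ _ hl h') (Nat.find_min (exists_return f S b) (by omega))
  · rw [he] at h'
    exact Subtype.ext ((f ^ (Nat.find (exists_return f S b) + 1)).injective h')
  · exact absurd (key b a _ _ hg h'.symm) (Nat.find_min (exists_return f S a) (by omega))

/-- The embedded subgraph formed by the edges whose darts lie in `S` and by their endpoints: around
each vertex one keeps the cyclic order of the darts that remain. -/
noncomputable def restrict (M : CombMap D) (S : Finset D) (hS : ∀ d, M.inv d ∈ S ↔ d ∈ S) :
    CombMap S where
  rot := Equiv.ofBijective _ (Finite.injective_iff_bijective.mp (firstReturn_injective M.rot S))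
  inv := M.inv.subtypePerm hS
  inv_inv d := Subtype.ext (M.inv_inv d)
  inv_ne d h := M.inv_ne d (congrArg Subtype.val h)

open Classical in
/-- The darts of the edges that have one endpoint of colour `i` and the other of colour `j`. -/
noncomputable def bichromaticDarts (M : CombMap D) {α : Type*} (c : M.Vertex → α) (i j : α) :
    Finset D :=
  Finset.univ.filter fun d =>
    (c (M.vert d) = i ∧ c (M.vert (M.inv d)) = j) ∨ (c (M.vert d) = j ∧ c (M.vert (M.inv d)) = i)

theorem inv_mem_bichromaticDarts (M : CombMap D) {α : Type*} (c : M.Vertex → α) (i j : α) (d : D) :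
    M.inv d ∈ M.bichromaticDarts c i j ↔ d ∈ M.bichromaticDarts c i j := by
  simp only [bichromaticDarts, Finset.mem_filter, Finset.mem_univ, true_and, M.inv_inv]
  tauto

/-- The embedded subgraph `G_ij` formed by the edges that join colour `i` to colour `j`. -/
noncomputable def bichromatic (M : CombMap D) {α : Type*} (c : M.Vertex → α) (i j : α) :
    CombMap (M.bichromaticDarts c i j) :=
  M.restrict (M.bichromaticDarts c i j) (M.inv_mem_bichromaticDarts c i j)

end Restrict

section Models

variable [Fintype D]

/-- The product `σ_a σ_b` over the two endpoints of an edge. A spin is an element `±1` of `ℤˣ`. -/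
noncomputable def edgeSpin (M : CombMap D) (σ : M.Vertex → ℤˣ) (e : M.Edge) : ℝ :=
  ∏ d with M.edge d = e, (((σ (M.vert d) : ℤˣ) : ℤ) : ℝ)

/-- The product of the spins at the corners of a face; `σ_a σ_b σ_c` for a triangle. -/
noncomputable def faceSpin (M : CombMap D) (σ : M.Vertex → ℤˣ) (f : M.Face) : ℝ :=
  ∏ d with M.face d = f, (((σ (M.vert d) : ℤˣ) : ℤ) : ℝ)

/-- The Hintermann–Merlini–Baxter–Wu Hamiltonian on a triangulation. -/
noncomputable def hamiltonianHMBW (M : CombMap D) (J : ℝ) (σ : M.Vertex → ℤˣ) : ℝ :=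
  -J * ∑ f : M.Face, M.faceSpin σ f

/-- The partition function of the Hintermann–Merlini–Baxter–Wu model. -/
noncomputable def partitionHMBW (M : CombMap D) (J : ℝ) : ℝ :=
  ∑ σ : M.Vertex → ℤˣ, Real.exp (-M.hamiltonianHMBW J σ)

/-- The mixed Ashkin–Teller Hamiltonian on a plane graph and its dual: spins `σ` on the
vertices of the graph and `τ` on the vertices of the dual. -/
noncomputable def hamiltonianMixedAT (M : CombMap D) (K₂ K₂' K₄ : ℝ)
    (σ : M.Vertex → ℤˣ) (τ : M.dual.Vertex → ℤˣ) : ℝ :=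
  -K₂ * ∑ e : M.Edge, M.edgeSpin σ e
    - K₂' * ∑ e' : M.dual.Edge, M.dual.edgeSpin τ e'
    - K₄ * ∑ e : M.Edge, M.edgeSpin σ e * M.dual.edgeSpin τ (M.dualEdge e)

/-- The partition function of the mixed Ashkin–Teller model on a plane graph and its dual. -/
noncomputable def partitionMixedAT (M : CombMap D) (K₂ K₂' K₄ : ℝ) : ℝ :=
  ∑ σ : M.Vertex → ℤˣ, ∑ τ : M.dual.Vertex → ℤˣ,
    Real.exp (-M.hamiltonianMixedAT K₂ K₂' K₄ σ τ)

end Models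

end CombMap

/-! A proper 3-colouring gives each triangle exactly one edge in $E_{13}$, and its opposite corner
lies in $V_2$. With $\tau=\sigma|_{V_2}$, the two triangles at an edge $\langle ab\rangle\in E_{13}$
therefore contribute $J\sigma_a\sigma_b(\tau+\tau')$ to the HMBW exponent, while the mixed
Ashkin–Teller exponent has $J\sigma_a\sigma_b(1+\tau\tau')$. For a sign $s$,
$s(\tau+\tau')=1+\tau\tau'$ means that $s$ is the common value if $\tau=\tau'$, and is no condition
otherwise.

A vertex of $V_3$ of degree 4 or 6 has degree 2 or 3 in $G_{13}$. In a cyclic word of two or three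
signs all equal neighbours have the same value, so one $s$ serves every edge at that vertex (the
word $++--$ shows that four would be too many). Each edge of $G_{13}$ has exactly one end in $V_3$,
so for fixed $\tau$ the bijection $\sigma_v\mapsto s_v\sigma_v$ on $V_3$ turns one exponent into the
other.

The geometry rests on the alternation of colours around a vertex: rotation in $G_{13}$ is `rot`
applied twice, and walking along a face of $G_{13}$ turns around the opposite vertex of $V_2$. This
identifies vertices and faces (`exists_vertexEquiv`, `exists_dualVertexEquiv`);
`exists_bichromatic_sign` supplies $s$. -/

namespace CombMap

/-! ### Orbits of a permutation and signs on short orbits -/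

section Cycle

variable {X : Type*}

/-- Used both to descend maps to orbits and, with `g` valued in `Prop`, to list the elements of a
short orbit. -/
theorem eq_of_sameCycle {β : Type*} {f : Equiv.Perm X} {g : X → β} (h : ∀ x, g (f x) = g x)
    {x y : X} (hxy : f.SameCycle x y) : g x = g y := by
  have hn : ∀ (n : ℕ) (x : X), g ((f ^ n) x) = g x := by
    intro n
    induction n with
    | zero => intro x; rfl
    | succ n ih => intro x; rw [pow_succ, Equiv.Perm.mul_apply, ih, h]
  obtain ⟨n, rfl⟩ := hxy
  cases n with
  | ofNat n => exact (hn n x).symm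
  | negSucc n =>
    rw [zpow_negSucc]
    have h' := hn (n + 1) ((f ^ (n + 1))⁻¹ x)
    rwa [← Equiv.Perm.mul_apply, mul_inv_cancel, Equiv.Perm.one_apply] at h'

/-- Among at most three cyclically arranged signs, two equal neighbouring pairs share an element, so
they have the same value; take that value for `s`. Unequal neighbours make both sides zero. -/
theorem exists_sign_of_period_two_or_three {f : Equiv.Perm X} {x : X}
    (hx : f (f x) = x ∨ f (f (f x)) = x) (u : X → ℤˣ) :
    ∃ s : ℤˣ, ∀ y, f.SameCycle x y →
      (((s : ℤˣ) : ℤ) : ℝ) * (((u y : ℤ) : ℝ) + ((u (f y) : ℤ) : ℝ)) =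
        1 + ((u y : ℤ) : ℝ) * ((u (f y) : ℤ) : ℝ) := by
  have orbit : ∀ y, f.SameCycle x y → y = x ∨ y = f x ∨ y = f (f x) := by
    have hP : ∀ y, (f y = x ∨ f y = f x ∨ f y = f (f x)) = (y = x ∨ y = f x ∨ y = f (f x)) := by
      intro y
      apply propext
      rcases hx with hx | hx
      · constructor
        · rintro (h | h | h)
          · exact .inr (.inl (f.injective (h.trans hx.symm)))
          · exact .inl (f.injective h)
          · exact .inr (.inl (f.injective h))
        · rintro (h | h | h) <;> subst h <;> simp [hx]
      · constructor
        · rintro (h | h | h)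
          · exact .inr (.inr (f.injective (h.trans hx.symm)))
          · exact .inl (f.injective h)
          · exact .inr (.inl (f.injective h))
        · rintro (h | h | h) <;> subst h <;> simp [hx]
    intro y hy
    exact (eq_of_sameCycle (g := fun y => y = x ∨ y = f x ∨ y = f (f x)) hP hy).mp (.inl rfl)
  suffices h : ∃ s : ℤˣ, ∀ y, (y = x ∨ y = f x ∨ y = f (f x)) →
      (((s : ℤˣ) : ℤ) : ℝ) * (((u y : ℤ) : ℝ) + ((u (f y) : ℤ) : ℝ)) =
        1 + ((u y : ℤ) : ℝ) * ((u (f y) : ℤ) : ℝ) by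
    obtain ⟨s, hs⟩ := h
    exact ⟨s, fun y hy => hs y (orbit y hy)⟩
  simp only [forall_eq_or_imp, forall_eq]
  rcases hx with hx | hx <;> simp only [hx] <;>
  rcases Int.units_eq_one_or (u x) with h0 | h0 <;>
  rcases Int.units_eq_one_or (u (f x)) with h1 | h1 <;>
  rcases Int.units_eq_one_or (u (f (f x))) with h2 | h2 <;>
  simp only [h0, h1, h2] <;>
  first
  | (refine ⟨1, ?_⟩; norm_num; done)
  | (refine ⟨-1, ?_⟩; norm_num)

end Cycle

/-! ### Darts, edges and faces of a combinatorial map -/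

section Basic

variable {D : Type*} (M : CombMap D)

theorem vert_eq_iff {d d' : D} : M.vert d = M.vert d' ↔ M.rot.SameCycle d d' := Quotient.eq

theorem face_eq_iff {d d' : D} : M.face d = M.face d' ↔ M.facePerm.SameCycle d d' := Quotient.eq

theorem edge_eq_iff_sameCycle {d d' : D} : M.edge d = M.edge d' ↔ M.inv.SameCycle d d' :=
  Quotient.eq

@[simp] theorem vert_rot (d : D) : M.vert (M.rot d) = M.vert d :=
  M.vert_eq_iff.mpr (Equiv.Perm.sameCycle_apply_left.mpr (.refl _ _))

@[simp] theorem face_facePerm (d : D) : M.face (M.facePerm d) = M.face d :=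
  M.face_eq_iff.mpr (Equiv.Perm.sameCycle_apply_left.mpr (.refl _ _))

@[simp] theorem edge_inv (d : D) : M.edge (M.inv d) = M.edge d :=
  M.edge_eq_iff_sameCycle.mpr (Equiv.Perm.sameCycle_apply_left.mpr (.refl _ _))

theorem facePerm_apply (d : D) : M.facePerm d = M.rot (M.inv d) := rfl

@[simp] theorem facePerm_inv (d : D) : M.facePerm (M.inv d) = M.rot d := by
  rw [facePerm_apply, M.inv_inv]

@[simp] theorem vert_facePerm (d : D) : M.vert (M.facePerm d) = M.vert (M.inv d) := by
  rw [facePerm_apply, vert_rot]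

theorem face_rot (d : D) : M.face (M.rot d) = M.face (M.inv d) := by
  rw [← facePerm_inv, face_facePerm]

theorem edge_eq_iff {d d' : D} : M.edge d = M.edge d' ↔ d = d' ∨ d = M.inv d' := by
  constructor
  · intro h
    have := eq_of_sameCycle (f := M.inv) (g := fun x => d = x ∨ d = M.inv x) (x := d) (y := d')
      (fun x => by rw [M.inv_inv]; exact propext or_comm) (M.edge_eq_iff_sameCycle.mp h)
    exact this.mp (.inl rfl)
  · rintro (rfl | rfl)
    · rfl
    · exact M.edge_inv d'

theorem face_eq_iff_of_triangle (h3 : ∀ d, M.facePerm (M.facePerm (M.facePerm d)) = d) {d d' : D} :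
    M.face d = M.face d' ↔
      d = d' ∨ d = M.facePerm d' ∨ d = M.facePerm (M.facePerm d') := by
  constructor
  · intro h
    have := eq_of_sameCycle (f := M.facePerm)
      (g := fun x => d = x ∨ d = M.facePerm x ∨ d = M.facePerm (M.facePerm x)) (x := d) (y := d')
      (fun x => by simp only [h3]; apply propext; tauto) (M.face_eq_iff.mp h)
    exact this.mp (.inl rfl)
  · rintro (rfl | rfl | rfl) <;> simp

section Finite

variable [Fintype D]

theorem edge_fiber [DecidableEq D] (d : D) :
    (Finset.univ.filter fun x => M.edge x = M.edge d) = {d, M.inv d} := by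
  ext x
  simp [edge_eq_iff]

theorem two_mul_card_edge : 2 * Fintype.card M.Edge = Fintype.card D := by
  classical
  rw [← Finset.card_univ (α := D),
    Finset.card_eq_sum_card_fiberwise (f := M.edge) (t := Finset.univ) (fun _ _ => by simp),
    Finset.sum_const_nat (m := 2)]
  · rw [Finset.card_univ, mul_comm]
  · intro e _
    obtain ⟨d, rfl⟩ : ∃ d, M.edge d = e := Quotient.exists_rep e
    rw [edge_fiber, Finset.card_pair (M.inv_ne d).symm]

theorem sum_edge (g : M.Edge → ℝ) : 2 * ∑ e, g e = ∑ d, g (M.edge d) := by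
  classical
  rw [← Finset.sum_fiberwise_of_maps_to (s := Finset.univ) (t := Finset.univ) (g := M.edge)
    (fun _ _ => Finset.mem_univ _), Finset.mul_sum]
  refine Finset.sum_congr rfl fun e _ => ?_
  obtain ⟨d, rfl⟩ : ∃ d, M.edge d = e := Quotient.exists_rep e
  rw [edge_fiber, Finset.sum_pair (M.inv_ne d).symm, edge_inv, two_mul]

theorem edgeSpin_edge (σ : M.Vertex → ℤˣ) (d : D) :
    M.edgeSpin σ (M.edge d) = ((σ (M.vert d) : ℤ) : ℝ) * ((σ (M.vert (M.inv d)) : ℤ) : ℝ) := by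
  classical
  rw [edgeSpin, edge_fiber, Finset.prod_pair (M.inv_ne d).symm]

theorem rot_pow_degree (d : D) : (M.rot ^ M.degree (M.vert d)) d = d := by
  classical
  -- A fixed dart is treated apart: its `cycleOf` has empty support, although its vertex has degree
  -- one.
  by_cases hd : M.rot d = d
  · exact Equiv.Perm.pow_apply_eq_self_of_apply_eq_self hd _
  have h : M.degree (M.vert d) = (M.rot.cycleOf d).support.card := by
    unfold degree
    congr 1
    ext x
    simp only [Finset.mem_filter, Finset.mem_univ, true_and,
      Equiv.Perm.mem_support_cycleOf_iff' hd]
    rw [eq_comm, vert_eq_iff]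
  rw [h, ← Equiv.Perm.pow_mod_card_support_cycleOf_self_apply, Nat.mod_self]
  rfl

omit [Fintype D] in
theorem exists_sign (τ : M.dual.Vertex → ℤˣ) {d : D}
    (hd : M.rot (M.rot d) = d ∨ M.rot (M.rot (M.rot d)) = d) :
    ∃ s : ℤˣ, ∀ x, M.vert x = M.vert d →
      ((s : ℤ) : ℝ) * (((τ (M.dual.vert x) : ℤ) : ℝ) + ((τ (M.dual.vert (M.inv x)) : ℤ) : ℝ)) =
        1 + ((τ (M.dual.vert x) : ℤ) : ℝ) * ((τ (M.dual.vert (M.inv x)) : ℤ) : ℝ) := by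
  obtain ⟨s, hs⟩ := exists_sign_of_period_two_or_three hd fun x => τ (M.dual.vert x)
  refine ⟨s, fun x hx => ?_⟩
  -- The two faces at an edge are those of consecutive darts around its tail, so the pairs of dual
  -- spins are neighbours in a cyclic word.
  have h : M.dual.vert (M.inv x) = M.dual.vert (M.rot x) := (M.face_rot x).symm
  rw [h]
  exact hs x (M.vert_eq_iff.mp hx.symm)

/-- The interaction energy of the mixed Ashkin–Teller model, as a sum over darts. -/
theorem two_mul_hamiltonianMixedAT (J : ℝ) (σ : M.Vertex → ℤˣ) (τ : M.dual.Vertex → ℤˣ) :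
    2 * -M.hamiltonianMixedAT J 0 J σ τ = J * ∑ d,
      ((σ (M.vert d) : ℤ) : ℝ) * ((σ (M.vert (M.inv d)) : ℤ) : ℝ) *
        (1 + ((τ (M.dual.vert d) : ℤ) : ℝ) * ((τ (M.dual.vert (M.inv d)) : ℤ) : ℝ)) := by
  have h1 := M.sum_edge (fun e => M.edgeSpin σ e)
  have h2 := M.sum_edge (fun e => M.edgeSpin σ e * M.dual.edgeSpin τ (M.dualEdge e))
  have h3 : ∀ d, M.dual.edgeSpin τ (M.dualEdge (M.edge d)) =
      ((τ (M.dual.vert d) : ℤ) : ℝ) * ((τ (M.dual.vert (M.inv d)) : ℤ) : ℝ) :=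
    fun d => M.dual.edgeSpin_edge τ d
  simp only [h3, edgeSpin_edge] at h1 h2
  simp only [mul_add, mul_one, Finset.sum_add_distrib]
  rw [← h1, ← h2, hamiltonianMixedAT]
  ring

end Finite

end Basic

/-! ### First return -/

section Return

variable {D : Type*} [Fintype D]

theorem firstReturn_eq_of_notMem {f : Equiv.Perm D} {S : Finset D} {d : S} (h1 : f d ∉ S)
    (h2 : f (f d) ∈ S) : (firstReturn f S d : D) = f (f d) := by
  classical
  -- The search index `n` stands for the power `n + 1`, so a return after two steps is index one.
  have h : Nat.find (exists_return f S d) = 1 := by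
    rw [Nat.find_eq_iff]
    refine ⟨by simpa [pow_succ] using h2, fun n hn => ?_⟩
    obtain rfl : n = 0 := by omega
    simpa using h1
  simp only [firstReturn, h]
  simp [pow_succ]

end Return

/-! ### Alternation of colours in a 3-coloured triangulation -/

section Tricoloured

variable {D : Type*} [Fintype D] {M : CombMap D} {c : M.Vertex → Fin 3} {i j k : Fin 3}

omit [Fintype D] in
theorem IsTriangulation.vert_opposite_ne (htri : M.IsTriangulation) (hc : M.IsProperColoring c)
    (d : D) : c (M.vert (M.facePerm (M.facePerm d))) ≠ c (M.vert d) ∧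
      c (M.vert (M.facePerm (M.facePerm d))) ≠ c (M.vert (M.inv d)) := by
  constructor
  · have := hc (M.facePerm (M.facePerm d))
    rwa [← vert_facePerm, (htri d).1] at this
  · have := hc (M.facePerm d)
    rw [vert_facePerm] at this
    rw [vert_facePerm]
    exact this.symm

/-- The three corners of a triangle carry all three colours, so an edge is known by the colour of
the opposite corner. -/
theorem IsTriangulation.mem_bichromaticDarts_iff (htri : M.IsTriangulation)
    (hc : M.IsProperColoring c) (hij : i ≠ j) (hik : i ≠ k) (hjk : j ≠ k) (d : D) :
    d ∈ M.bichromaticDarts c i k ↔ c (M.vert (M.facePerm (M.facePerm d))) = j := by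
  have h0 := hc d
  obtain ⟨h1, h2⟩ := htri.vert_opposite_ne hc d
  simp only [bichromaticDarts, Finset.mem_filter, Finset.mem_univ, true_and]
  generalize c (M.vert d) = x at *
  generalize c (M.vert (M.inv d)) = y at *
  generalize c (M.vert (M.facePerm (M.facePerm d))) = z at *
  omega

theorem IsTriangulation.rot_mem_bichromaticDarts_iff (htri : M.IsTriangulation)
    (hc : M.IsProperColoring c) (hij : i ≠ j) (hik : i ≠ k) (hjk : j ≠ k) (d : D) :
    M.rot d ∈ M.bichromaticDarts c i k ↔ c (M.vert (M.inv d)) = j := by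
  rw [htri.mem_bichromaticDarts_iff hc hij hik hjk, ← facePerm_inv, (htri _).1]

theorem IsTriangulation.rot_rot_mem_bichromaticDarts_iff (htri : M.IsTriangulation)
    (hc : M.IsProperColoring c) (hij : i ≠ j) (hik : i ≠ k) (hjk : j ≠ k) (d : D) :
    M.rot (M.rot d) ∈ M.bichromaticDarts c i k ↔ d ∈ M.bichromaticDarts c i k := by
  rw [htri.rot_mem_bichromaticDarts_iff hc hij hik hjk, ← vert_facePerm, ← facePerm_inv,
    ← htri.mem_bichromaticDarts_iff hc hij hik hjk, inv_mem_bichromaticDarts]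

theorem IsTriangulation.facePerm_mem_bichromaticDarts_iff (htri : M.IsTriangulation)
    (hc : M.IsProperColoring c) (hij : i ≠ j) (hik : i ≠ k) (hjk : j ≠ k) (d : D) :
    M.facePerm d ∈ M.bichromaticDarts c i k ↔ c (M.vert d) = j := by
  rw [htri.mem_bichromaticDarts_iff hc hij hik hjk, (htri d).1]

theorem IsTriangulation.rot_notMem_bichromaticDarts (htri : M.IsTriangulation)
    (hc : M.IsProperColoring c) (hij : i ≠ j) (hik : i ≠ k) (hjk : j ≠ k) {d : D}
    (hd : d ∈ M.bichromaticDarts c i k) : M.rot d ∉ M.bichromaticDarts c i k := by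
  rw [htri.rot_mem_bichromaticDarts_iff hc hij hik hjk]
  rw [htri.mem_bichromaticDarts_iff hc hij hik hjk] at hd
  rw [← hd]
  exact (htri.vert_opposite_ne hc d).2.symm

theorem IsTriangulation.mem_or_rot_mem_bichromaticDarts (htri : M.IsTriangulation)
    (hc : M.IsProperColoring c) (hij : i ≠ j) (hik : i ≠ k) (hjk : j ≠ k) {d : D}
    (hd : c (M.vert d) ≠ j) :
    d ∈ M.bichromaticDarts c i k ∨ M.rot d ∈ M.bichromaticDarts c i k := by
  rw [htri.mem_bichromaticDarts_iff hc hij hik hjk,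
    htri.rot_mem_bichromaticDarts_iff hc hij hik hjk]
  have h0 := hc d
  obtain ⟨h1, h2⟩ := htri.vert_opposite_ne hc d
  omega

theorem vert_ne_of_mem_bichromaticDarts (hij : i ≠ j) (hjk : j ≠ k) {d : D}
    (hd : d ∈ M.bichromaticDarts c i k) : c (M.vert d) ≠ j := by
  simp only [bichromaticDarts, Finset.mem_filter, Finset.mem_univ, true_and] at hd
  omega

theorem bichromatic_inv_coe (d : M.bichromaticDarts c i k) :
    ((M.bichromatic c i k).inv d : D) = M.inv d := rfl

theorem IsTriangulation.bichromatic_rot_coe (htri : M.IsTriangulation)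
    (hc : M.IsProperColoring c) (hij : i ≠ j) (hik : i ≠ k) (hjk : j ≠ k)
    (d : M.bichromaticDarts c i k) :
    ((M.bichromatic c i k).rot d : D) = M.rot (M.rot d) :=
  firstReturn_eq_of_notMem (htri.rot_notMem_bichromaticDarts hc hij hik hjk d.2)
    ((htri.rot_rot_mem_bichromaticDarts_iff hc hij hik hjk _).mpr d.2)

theorem IsTriangulation.bichromatic_facePerm_coe (htri : M.IsTriangulation)
    (hc : M.IsProperColoring c) (hij : i ≠ j) (hik : i ≠ k) (hjk : j ≠ k)
    (d : M.bichromaticDarts c i k) :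
    ((M.bichromatic c i k).facePerm d : D) = M.facePerm (M.inv (M.facePerm d)) := by
  rw [facePerm_apply, htri.bichromatic_rot_coe hc hij hik hjk, bichromatic_inv_coe, facePerm_inv,
    facePerm_apply]

/-- One step along a face of the subgraph is one step backwards around the vertex opposite to the
edge, which is why faces correspond to vertices of the third colour. -/
theorem IsTriangulation.rot_opposite_bichromatic_facePerm (htri : M.IsTriangulation)
    (hc : M.IsProperColoring c) (hij : i ≠ j) (hik : i ≠ k) (hjk : j ≠ k)
    (d : M.bichromaticDarts c i k) :
    M.rot (M.facePerm (M.facePerm ((M.bichromatic c i k).facePerm d))) =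
      M.facePerm (M.facePerm d) := by
  rw [htri.bichromatic_facePerm_coe hc hij hik hjk, (htri _).1, ← facePerm_apply]

theorem IsTriangulation.sameCycle_bichromatic_rot (htri : M.IsTriangulation)
    (hc : M.IsProperColoring c) (hij : i ≠ j) (hik : i ≠ k) (hjk : j ≠ k)
    (d d' : M.bichromaticDarts c i k) (h : M.rot.SameCycle (d : D) d') :
    (M.bichromatic c i k).rot.SameCycle d d' := by
  obtain ⟨n, -, hn⟩ := h.exists_pow_eq'
  clear h
  -- Subgraph rotation is two steps of `rot`, so the exponent falls by two; exponent one is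
  -- impossible because `rot` leaves the subgraph.
  induction n using Nat.strong_induction_on generalizing d with
  | _ n ih =>
    match n, hn with
    | 0, hn => rw [Subtype.ext (a1 := d) (a2 := d') hn]
    | 1, hn =>
      have := htri.rot_notMem_bichromaticDarts hc hij hik hjk d.2
      rw [pow_one] at hn
      rw [hn] at this
      exact absurd d'.2 this
    | n + 2, hn =>
      rw [← Equiv.Perm.sameCycle_apply_left]
      apply ih n (by omega)
      rw [htri.bichromatic_rot_coe hc hij hik hjk, ← hn, pow_add]
      simp [pow_succ]

theorem IsTriangulation.sameCycle_bichromatic_facePerm (htri : M.IsTriangulation)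
    (hc : M.IsProperColoring c) (hij : i ≠ j) (hik : i ≠ k) (hjk : j ≠ k)
    (d d' : M.bichromaticDarts c i k)
    (h : M.rot.SameCycle (M.facePerm (M.facePerm d)) (M.facePerm (M.facePerm d'))) :
    (M.bichromatic c i k).facePerm.SameCycle d d' := by
  obtain ⟨n, -, hn⟩ := h.exists_pow_eq'
  clear h
  induction n generalizing d with
  | zero =>
    have : d = d' := Subtype.ext (M.facePerm.injective (M.facePerm.injective hn))
    rw [this]
  | succ n ih =>
    -- The walk along the face turns against `rot`, so a forward step of `rot` replaces `d` by its
    -- predecessor on the face.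
    obtain ⟨e, rfl⟩ := (M.bichromatic c i k).facePerm.surjective d
    rw [Equiv.Perm.sameCycle_apply_left]
    apply ih
    rw [← htri.rot_opposite_bichromatic_facePerm hc hij hik hjk e, ← hn, pow_succ]
    rfl

/-! ### Vertices, edges and faces of the bichromatic subgraph -/

theorem IsTriangulation.exists_vertexEquiv (htri : M.IsTriangulation)
    (hc : M.IsProperColoring c) (hij : i ≠ j) (hik : i ≠ k) (hjk : j ≠ k) :
    ∃ eV : (M.bichromatic c i k).Vertex ≃ {v : M.Vertex // c v = i ∨ c v = k},
      ∀ d, (eV ((M.bichromatic c i k).vert d) : M.Vertex) = M.vert d := by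
  have hcol : ∀ d : M.bichromaticDarts c i k, c (M.vert d) = i ∨ c (M.vert d) = k := by
    intro d
    have := vert_ne_of_mem_bichromaticDarts hij hjk d.2
    omega
  let F : (M.bichromatic c i k).Vertex → {v : M.Vertex // c v = i ∨ c v = k} :=
    Quotient.lift (fun d => ⟨M.vert d, hcol d⟩) fun a b hab =>
      eq_of_sameCycle (f := (M.bichromatic c i k).rot)
        (g := fun d => (⟨M.vert d, hcol d⟩ : {v : M.Vertex // c v = i ∨ c v = k}))
        (fun x => Subtype.ext (by
        show M.vert _ = M.vert _
        rw [htri.bichromatic_rot_coe hc hij hik hjk, vert_rot, vert_rot])) hab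
  have hF : ∀ d, (F ((M.bichromatic c i k).vert d) : M.Vertex) = M.vert d := fun _ => rfl
  refine ⟨Equiv.ofBijective F ⟨?_, ?_⟩, hF⟩
  · intro a b hab
    obtain ⟨d, rfl⟩ : ∃ d, (M.bichromatic c i k).vert d = a := Quotient.exists_rep a
    obtain ⟨d', rfl⟩ : ∃ d, (M.bichromatic c i k).vert d = b := Quotient.exists_rep b
    have := congrArg Subtype.val hab
    rw [hF, hF, vert_eq_iff] at this
    exact (vert_eq_iff _).mpr (htri.sameCycle_bichromatic_rot hc hij hik hjk d d' this)
  · rintro ⟨v, hv⟩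
    obtain ⟨x, rfl⟩ : ∃ d, M.vert d = v := Quotient.exists_rep v
    rcases htri.mem_or_rot_mem_bichromaticDarts hc hij hik hjk (d := x) (by omega) with hx | hx
    · exact ⟨(M.bichromatic c i k).vert ⟨x, hx⟩, Subtype.ext (hF _)⟩
    · exact ⟨(M.bichromatic c i k).vert ⟨M.rot x, hx⟩, Subtype.ext ((hF _).trans (M.vert_rot x))⟩

theorem IsTriangulation.exists_dualVertexEquiv (htri : M.IsTriangulation)
    (hc : M.IsProperColoring c) (hij : i ≠ j) (hik : i ≠ k) (hjk : j ≠ k) :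
    ∃ eF : (M.bichromatic c i k).dual.Vertex ≃ {v : M.Vertex // c v = j},
      ∀ d, (eF ((M.bichromatic c i k).dual.vert d) : M.Vertex) =
        M.vert (M.facePerm (M.facePerm d)) := by
  let F : (M.bichromatic c i k).dual.Vertex → {v : M.Vertex // c v = j} :=
    Quotient.lift (fun d => ⟨M.vert (M.facePerm (M.facePerm d)),
        (htri.mem_bichromaticDarts_iff hc hij hik hjk d).mp d.2⟩) fun a b hab =>
      eq_of_sameCycle (f := (M.bichromatic c i k).facePerm)
        (g := fun d => (⟨M.vert (M.facePerm (M.facePerm d)),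
          (htri.mem_bichromaticDarts_iff hc hij hik hjk d).mp d.2⟩ : {v : M.Vertex // c v = j}))
        (fun x => Subtype.ext (by
        show M.vert _ = M.vert _
        rw [← htri.rot_opposite_bichromatic_facePerm hc hij hik hjk x, vert_rot])) hab
  have hF : ∀ d, (F ((M.bichromatic c i k).dual.vert d) : M.Vertex) =
      M.vert (M.facePerm (M.facePerm d)) := fun _ => rfl
  refine ⟨Equiv.ofBijective F ⟨?_, ?_⟩, hF⟩
  · intro a b hab
    obtain ⟨d, rfl⟩ : ∃ d, (M.bichromatic c i k).dual.vert d = a := Quotient.exists_rep a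
    obtain ⟨d', rfl⟩ : ∃ d, (M.bichromatic c i k).dual.vert d = b := Quotient.exists_rep b
    have := congrArg Subtype.val hab
    rw [hF, hF, vert_eq_iff] at this
    exact (vert_eq_iff _).mpr (htri.sameCycle_bichromatic_facePerm hc hij hik hjk d d' this)
  · rintro ⟨v, hv⟩
    obtain ⟨x, rfl⟩ : ∃ d, M.vert d = v := Quotient.exists_rep v
    refine ⟨(M.bichromatic c i k).dual.vert ⟨M.facePerm x,
      (htri.facePerm_mem_bichromaticDarts_iff hc hij hik hjk x).mpr hv⟩, Subtype.ext ?_⟩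
    rw [hF, (htri x).1]

/-- Every triangle has exactly one edge that joins the two given colours. -/
theorem IsTriangulation.face_bijective (htri : M.IsTriangulation)
    (hc : M.IsProperColoring c) (hij : i ≠ j) (hik : i ≠ k) (hjk : j ≠ k) :
    Function.Bijective fun d : M.bichromaticDarts c i k => M.face d := by
  have hmem := htri.mem_bichromaticDarts_iff hc hij hik hjk
  constructor
  · rintro ⟨a, ha⟩ ⟨b, hb⟩ hab
    apply Subtype.ext
    obtain ⟨h1, h2⟩ := htri.vert_opposite_ne hc b
    rw [hmem] at ha hb
    have hab' : M.face a = M.face b := hab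
    rcases (M.face_eq_iff_of_triangle fun d => (htri d).1).mp hab' with h | h | h
    · exact h
    · rw [h, (htri b).1] at ha
      exact absurd (hb.trans ha.symm) h1
    · rw [h, (htri b).1, vert_facePerm] at ha
      exact absurd (hb.trans ha.symm) h2
  · intro f
    obtain ⟨x, rfl⟩ : ∃ d, M.face d = f := Quotient.exists_rep f
    obtain ⟨h1, h2⟩ := htri.vert_opposite_ne hc x
    have h0 := hc x
    have : c (M.vert (M.facePerm (M.facePerm x))) = j ∨ c (M.vert x) = j ∨
      c (M.vert (M.inv x)) = j := by omega
    rcases this with h | h | h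
    · exact ⟨⟨x, (hmem x).mpr h⟩, rfl⟩
    · exact ⟨⟨M.facePerm x, (hmem _).mpr (by rwa [(htri x).1])⟩, by simp⟩
    · exact ⟨⟨M.facePerm (M.facePerm x), (hmem _).mpr (by rwa [(htri x).1, vert_facePerm])⟩,
        by simp⟩

omit [Fintype D] in
theorem IsTriangulation.facePerm_ne (htri : M.IsTriangulation) (d : D) : M.facePerm d ≠ d :=
  fun h => (htri d).2 (by rw [h])

omit [Fintype D] in
theorem IsTriangulation.facePerm_facePerm_ne (htri : M.IsTriangulation) (d : D) :
    M.facePerm (M.facePerm d) ≠ d := by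
  intro h
  have := (htri d).1
  rw [h] at this
  exact htri.facePerm_ne d this

theorem IsTriangulation.face_fiber [DecidableEq D] (htri : M.IsTriangulation) (d : D) :
    (Finset.univ.filter fun x => M.face x = M.face d) =
      {d, M.facePerm d, M.facePerm (M.facePerm d)} := by
  ext x
  simp [M.face_eq_iff_of_triangle fun d => (htri d).1]

theorem IsTriangulation.three_mul_card_face (htri : M.IsTriangulation) :
    3 * Fintype.card M.Face = Fintype.card D := by
  classical
  rw [← Finset.card_univ (α := D),
    Finset.card_eq_sum_card_fiberwise (f := M.face) (t := Finset.univ) (fun _ _ => by simp),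
    Finset.sum_const_nat (m := 3)]
  · rw [Finset.card_univ, mul_comm]
  · intro f _
    obtain ⟨d, rfl⟩ : ∃ d, M.face d = f := Quotient.exists_rep f
    rw [htri.face_fiber, Finset.card_eq_three]
    exact ⟨_, _, _, (htri.facePerm_ne d).symm, (htri.facePerm_facePerm_ne d).symm,
      (htri.facePerm_ne _).symm, rfl⟩

theorem IsTriangulation.faceSpin_face (htri : M.IsTriangulation) (σ : M.Vertex → ℤˣ) (d : D) :
    M.faceSpin σ (M.face d) = ((σ (M.vert d) : ℤ) : ℝ) * ((σ (M.vert (M.inv d)) : ℤ) : ℝ) *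
      ((σ (M.vert (M.facePerm (M.facePerm d))) : ℤ) : ℝ) := by
  classical
  rw [faceSpin, htri.face_fiber, Finset.prod_insert, Finset.prod_pair (htri.facePerm_ne _).symm,
    vert_facePerm (d := d), mul_assoc]
  simp [(htri.facePerm_ne d).symm, (htri.facePerm_facePerm_ne d).symm]

/-! ### Connectedness and Euler characteristic -/

theorem IsTriangulation.bichromatic_isConnected (htri : M.IsTriangulation)
    (hconn : M.IsConnected) (hc : M.IsProperColoring c) (hij : i ≠ j) (hik : i ≠ k)
    (hjk : j ≠ k) : (M.bichromatic c i k).IsConnected := by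
  classical
  set N := M.bichromatic c i k
  let H := Subgroup.closure {N.rot, N.inv}
  let q : M.bichromaticDarts c i k → MulAction.orbitRel.Quotient H (M.bichromaticDarts c i k) :=
    fun d => Quotient.mk _ d
  have hq : ∀ g ∈ H, ∀ d, q (g d) = q d := fun g hg d => Quotient.sound ⟨⟨g, hg⟩, rfl⟩
  have hrot : N.rot ∈ H := Subgroup.subset_closure (by simp)
  have hinv : N.inv ∈ H := Subgroup.subset_closure (by simp)
  have hface : N.facePerm ∈ H := H.mul_mem hrot hinv
  have hmf := htri.facePerm_mem_bichromaticDarts_iff hc hij hik hjk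
  -- the orbit to which a dart of `M` belongs: `P x a` says that it is the orbit `a`
  let P : D → MulAction.orbitRel.Quotient H (M.bichromaticDarts c i k) → Prop := fun x a =>
    (∀ h : x ∈ M.bichromaticDarts c i k, q ⟨x, h⟩ = a) ∧
    (∀ h : M.rot x ∈ M.bichromaticDarts c i k, c (M.vert x) ≠ j → q ⟨M.rot x, h⟩ = a) ∧
    (∀ h : M.facePerm x ∈ M.bichromaticDarts c i k, q ⟨M.facePerm x, h⟩ = a)
  have hprot : ∀ x a, P (M.rot x) a → P x a := by
    rintro x a ⟨h1, h2, h3⟩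
    refine ⟨fun h => ?_, fun h _ => h1 h, fun h => ?_⟩
    · have hr := (htri.rot_rot_mem_bichromaticDarts_iff hc hij hik hjk x).mpr h
      rw [← h2 hr (by rw [vert_rot]; exact vert_ne_of_mem_bichromaticDarts hij hjk h),
        ← hq _ hrot]
      congr 1
      exact Subtype.ext (htri.bichromatic_rot_coe hc hij hik hjk ⟨x, h⟩)
    · have hr : M.facePerm (M.rot x) ∈ M.bichromaticDarts c i k := by
        rw [hmf, vert_rot, ← hmf]; exact h
      rw [← h3 hr, ← hq _ hface ⟨M.facePerm (M.rot x), hr⟩]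
      congr 1
      apply Subtype.ext
      have := htri.rot_opposite_bichromatic_facePerm hc hij hik hjk ⟨M.facePerm (M.rot x), hr⟩
      rw [(htri _).1] at this
      have := M.rot.injective this
      rw [← (htri (N.facePerm ⟨M.facePerm (M.rot x), hr⟩)).1, this]
  have hpinv : ∀ x a, P (M.inv x) a → P x a := by
    rintro x a ⟨h1, h2, h3⟩
    refine ⟨fun h => ?_, fun h _ => ?_, fun h => ?_⟩
    · rw [← h1 ((M.inv_mem_bichromaticDarts c i k x).mpr h), ← hq _ hinv]
      rfl
    · have h' : M.facePerm (M.inv x) ∈ M.bichromaticDarts c i k := by rwa [facePerm_inv]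
      rw [← h3 h']
      congr 1
      exact Subtype.ext (M.facePerm_inv x).symm
    · refine h2 h ?_
      rw [hmf] at h
      rw [← h]
      exact (hc x).symm
  have hpall : ∀ g ∈ Subgroup.closure {M.rot, M.inv}, ∀ x a, P (g x) a ↔ P x a := by
    intro g hg
    have key : ∀ f : Equiv.Perm D, (∀ x a, P (f x) a → P x a) → ∀ x a, P (f x) a ↔ P x a := by
      intro f hf x a
      refine ⟨hf x a, fun h => ?_⟩
      -- Since `f` has finite order, iterating the one implication all the way around gives its
      -- converse.
      have hn : ∀ n : ℕ, ∀ y, P ((f ^ n) y) a → P y a := by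
        intro n
        induction n with
        | zero => exact fun y hy => hy
        | succ n ih => exact fun y hy => hf y a (ih (f y) hy)
      have := hn (orderOf f - 1) (f x)
      rw [← Equiv.Perm.mul_apply, ← pow_succ, Nat.sub_add_cancel (orderOf_pos f),
        pow_orderOf_eq_one] at this
      exact this h
    induction hg using Subgroup.closure_induction with
    | mem f hf =>
      rcases hf with rfl | rfl
      · exact key _ hprot
      · exact key _ hpinv
    | one => exact fun x a => Iff.rfl
    | mul f g _ _ hf hg => exact fun x a => (hf (g x) a).trans (hg x a)
    | inv f _ hf =>
      intro x a
      rw [← hf, ← Equiv.Perm.mul_apply, mul_inv_cancel, Equiv.Perm.one_apply]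
  intro d d'
  obtain ⟨g, hg, hgd⟩ := hconn d' d
  have hd : P d (q d) := by
    refine ⟨fun _ => rfl, fun h => ?_, fun h => ?_⟩
    · exact absurd h (htri.rot_notMem_bichromaticDarts hc hij hik hjk d.2)
    · rw [hmf] at h
      exact absurd h (vert_ne_of_mem_bichromaticDarts hij hjk d.2)
  rw [← hgd, hpall g hg] at hd
  obtain ⟨⟨g, hg⟩, h⟩ : d' ∈ MulAction.orbit H d := Quotient.exact (hd.1 d'.2)
  exact ⟨g, hg, h⟩

theorem IsTriangulation.bichromatic_isPlane (htri : M.IsTriangulation)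
    (hplane : M.IsPlane) (hc : M.IsProperColoring c) (hij : i ≠ j) (hik : i ≠ k)
    (hjk : j ≠ k) : (M.bichromatic c i k).IsPlane := by
  classical
  refine ⟨htri.bichromatic_isConnected hplane.1 hc hij hik hjk, ?_⟩
  obtain ⟨eV, -⟩ := htri.exists_vertexEquiv hc hij hik hjk
  obtain ⟨eF, -⟩ := htri.exists_dualVertexEquiv hc hij hik hjk
  have h1 : Fintype.card (M.bichromatic c i k).Vertex + Fintype.card (M.bichromatic c i k).Face =
      Fintype.card M.Vertex := by
    have e : (M.bichromatic c i k).Vertex ⊕ (M.bichromatic c i k).Face ≃ M.Vertex :=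
      (eV.sumCongr ((show (M.bichromatic c i k).Face ≃ _ from eF).trans
        (Equiv.subtypeEquivRight fun v => by omega))).trans
        (Equiv.sumCompl fun v => c v = i ∨ c v = k)
    rw [← Fintype.card_congr e, Fintype.card_sum]
  have h2 := (M.bichromatic c i k).two_mul_card_edge
  have h3 := Fintype.card_of_bijective (htri.face_bijective hc hij hik hjk)
  have h4 := htri.three_mul_card_face
  have h5 := M.two_mul_card_edge
  have h6 := hplane.2
  -- The subgraph has $V$ vertices and faces together and $F/2$ edges, and $3F=2E$ gives
  -- $V-F/2=V-E+F=2$.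
  omega

/-! ### Change of signs on the third class and comparison of partition functions -/

theorem IsTriangulation.bichromatic_rot_period (htri : M.IsTriangulation)
    (hc : M.IsProperColoring c) (hij : i ≠ j) (hik : i ≠ k) (hjk : j ≠ k)
    (d : M.bichromaticDarts c i k)
    (hd : M.degree (M.vert d) = 4 ∨ M.degree (M.vert d) = 6) :
    (M.bichromatic c i k).rot ((M.bichromatic c i k).rot d) = d ∨
      (M.bichromatic c i k).rot ((M.bichromatic c i k).rot ((M.bichromatic c i k).rot d)) = d := by
  have hr := htri.bichromatic_rot_coe hc hij hik hjk
  have hp := M.rot_pow_degree d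
  rcases hd with hd | hd <;> rw [hd] at hp
  · left
    apply Subtype.ext
    rw [hr, hr]
    exact hp
  · right
    apply Subtype.ext
    rw [hr, hr, hr]
    exact hp

theorem IsTriangulation.exists_bichromatic_sign (htri : M.IsTriangulation)
    (hc : M.IsProperColoring c) (hij : i ≠ j) (hik : i ≠ k) (hjk : j ≠ k)
    (hdeg : ∀ v, c v = k → M.degree v = 4 ∨ M.degree v = 6)
    (τ : (M.bichromatic c i k).dual.Vertex → ℤˣ) :
    ∃ s : (M.bichromatic c i k).Vertex → ℤˣ, ∀ d,
      ((s ((M.bichromatic c i k).vert d) : ℤ) : ℝ) *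
        ((s ((M.bichromatic c i k).vert ((M.bichromatic c i k).inv d)) : ℤ) : ℝ) *
        (((τ ((M.bichromatic c i k).dual.vert d) : ℤ) : ℝ) +
          ((τ ((M.bichromatic c i k).dual.vert ((M.bichromatic c i k).inv d)) : ℤ) : ℝ)) =
      1 + ((τ ((M.bichromatic c i k).dual.vert d) : ℤ) : ℝ) *
          ((τ ((M.bichromatic c i k).dual.vert ((M.bichromatic c i k).inv d)) : ℤ) : ℝ) := by
  classical
  obtain ⟨eV, hV⟩ := htri.exists_vertexEquiv hc hij hik hjk
  have hw : ∀ w : (M.bichromatic c i k).Vertex, ∃ s : ℤˣ, (c (eV w) = i → s = 1) ∧ (c (eV w) = k →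
      ∀ x, (M.bichromatic c i k).vert x = w →
      ((s : ℤ) : ℝ) * (((τ ((M.bichromatic c i k).dual.vert x) : ℤ) : ℝ) +
        ((τ ((M.bichromatic c i k).dual.vert ((M.bichromatic c i k).inv x)) : ℤ) : ℝ)) =
        1 + ((τ ((M.bichromatic c i k).dual.vert x) : ℤ) : ℝ) *
          ((τ ((M.bichromatic c i k).dual.vert ((M.bichromatic c i k).inv x)) : ℤ) : ℝ)) := by
    intro w
    by_cases h : c (eV w) = k
    · obtain ⟨d, rfl⟩ : ∃ d, (M.bichromatic c i k).vert d = w := Quotient.exists_rep w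
      rw [hV] at h ⊢
      obtain ⟨s, hs⟩ := (M.bichromatic c i k).exists_sign τ
        (htri.bichromatic_rot_period hc hij hik hjk d (hdeg _ h))
      exact ⟨s, fun h' => absurd (h'.symm.trans h) hik, fun _ => hs⟩
    · exact ⟨1, fun _ => rfl, fun h' => absurd h' h⟩
  choose s hs1 hs2 using hw
  -- Every edge has one end of colour `i`, where the sign is 1, so only the sign at its end of
  -- colour `k` enters.
  refine ⟨s, fun d => ?_⟩
  have hd := d.2
  simp only [bichromaticDarts, Finset.mem_filter, Finset.mem_univ, true_and] at hd
  rcases hd with ⟨ha, hb⟩ | ⟨ha, hb⟩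
  · have h1 := hs1 ((M.bichromatic c i k).vert d) (by rw [hV]; exact ha)
    have h2 := hs2 ((M.bichromatic c i k).vert ((M.bichromatic c i k).inv d)) (by rw [hV]; exact hb)
      ((M.bichromatic c i k).inv d) rfl
    rw [(M.bichromatic c i k).inv_inv] at h2
    rw [h1]
    push_cast
    linarith
  · have h1 := hs1 ((M.bichromatic c i k).vert ((M.bichromatic c i k).inv d)) (by rw [hV]; exact hb)
    have h2 := hs2 ((M.bichromatic c i k).vert d) (by rw [hV]; exact ha) d rfl
    rw [h1]
    push_cast
    linarith

/-- The energy of the Hintermann–Merlini–Baxter–Wu model, as a sum over the darts of the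
bichromatic subgraph. -/
theorem IsTriangulation.two_mul_hamiltonianHMBW (htri : M.IsTriangulation)
    (hc : M.IsProperColoring c) (hij : i ≠ j) (hik : i ≠ k) (hjk : j ≠ k) (J : ℝ)
    (ρ : M.Vertex → ℤˣ) (σ : (M.bichromatic c i k).Vertex → ℤˣ)
    (τ : (M.bichromatic c i k).dual.Vertex → ℤˣ)
    (hσ : ∀ d, σ ((M.bichromatic c i k).vert d) = ρ (M.vert d))
    (hτ : ∀ d, τ ((M.bichromatic c i k).dual.vert d) = ρ (M.vert (M.facePerm (M.facePerm d)))) :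
    2 * -M.hamiltonianHMBW J ρ = J * ∑ d,
      ((σ ((M.bichromatic c i k).vert d) : ℤ) : ℝ) *
        ((σ ((M.bichromatic c i k).vert ((M.bichromatic c i k).inv d)) : ℤ) : ℝ) *
        (((τ ((M.bichromatic c i k).dual.vert d) : ℤ) : ℝ) +
          ((τ ((M.bichromatic c i k).dual.vert ((M.bichromatic c i k).inv d)) : ℤ) : ℝ)) := by
  have h1 : ∑ f, M.faceSpin ρ f = ∑ d, ((σ ((M.bichromatic c i k).vert d) : ℤ) : ℝ) *
      ((σ ((M.bichromatic c i k).vert ((M.bichromatic c i k).inv d)) : ℤ) : ℝ) *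
        ((τ ((M.bichromatic c i k).dual.vert d) : ℤ) : ℝ) := by
    rw [← (htri.face_bijective hc hij hik hjk).sum_comp]
    refine Finset.sum_congr rfl fun d _ => ?_
    rw [htri.faceSpin_face, hσ, hσ, hτ]
    rfl
  have h2 : ∑ f, M.faceSpin ρ f = ∑ d, ((σ ((M.bichromatic c i k).vert d) : ℤ) : ℝ) *
      ((σ ((M.bichromatic c i k).vert ((M.bichromatic c i k).inv d)) : ℤ) : ℝ) *
        ((τ ((M.bichromatic c i k).dual.vert ((M.bichromatic c i k).inv d)) : ℤ) : ℝ) := by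
    -- Reversing darts exchanges the two triangles at each edge; averaging both forms of the sum
    -- makes it symmetric in the two dual spins.
    rw [h1, ← Equiv.sum_comp (M.bichromatic c i k).inv]
    refine Finset.sum_congr rfl fun d _ => ?_
    rw [(M.bichromatic c i k).inv_inv]
    ring
  simp only [mul_add, Finset.sum_add_distrib]
  rw [← h1, ← h2, hamiltonianHMBW]
  ring

theorem IsTriangulation.partitionHMBW_eq_partitionMixedAT (htri : M.IsTriangulation)
    (hc : M.IsProperColoring c) (hij : i ≠ j) (hik : i ≠ k) (hjk : j ≠ k)
    (hdeg : ∀ v, c v = k → M.degree v = 4 ∨ M.degree v = 6) (J : ℝ) :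
    M.partitionHMBW J = (M.bichromatic c i k).partitionMixedAT J 0 J := by
  classical
  obtain ⟨eV, hV⟩ := htri.exists_vertexEquiv hc hij hik hjk
  obtain ⟨eF, hF⟩ := htri.exists_dualVertexEquiv hc hij hik hjk
  choose s hs using htri.exists_bichromatic_sign hc hij hik hjk hdeg
  have hat := (M.bichromatic c i k).two_mul_hamiltonianMixedAT J
  have hbw := htri.two_mul_hamiltonianHMBW hc hij hik hjk J
  let e : (M.bichromatic c i k).Vertex ⊕ (M.bichromatic c i k).dual.Vertex ≃ M.Vertex :=
    (eV.sumCongr (eF.trans (Equiv.subtypeEquivRight fun v => by omega))).trans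
      (Equiv.sumCompl fun v => c v = i ∨ c v = k)
  have heV : ∀ d : M.bichromaticDarts c i k,
      e.symm (M.vert d) = Sum.inl ((M.bichromatic c i k).vert d) := fun d => by
    rw [Equiv.symm_apply_eq]
    exact (hV d).symm
  have heF : ∀ d : M.bichromaticDarts c i k,
      e.symm (M.vert (M.facePerm (M.facePerm d))) =
        Sum.inr ((M.bichromatic c i k).dual.vert d) := fun d => by
    rw [Equiv.symm_apply_eq]
    exact (hF d).symm
  let E : ((M.bichromatic c i k).Vertex → ℤˣ) × ((M.bichromatic c i k).dual.Vertex → ℤˣ) ≃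
      (M.Vertex → ℤˣ) :=
    (Equiv.sumArrowEquivProdArrow _ _ _).symm.trans (e.arrowCongr (Equiv.refl _))
  have hE : ∀ σ τ v, E (σ, τ) v = Sum.elim σ τ (e.symm v) := fun _ _ _ => rfl
  rw [partitionHMBW, partitionMixedAT, ← Equiv.sum_comp E, Fintype.sum_prod_type_right,
    Finset.sum_comm (s := Finset.univ (α := (M.bichromatic c i k).Vertex → ℤˣ))]
  refine Finset.sum_congr rfl fun τ _ => ?_
  -- The signs depend on `τ`, so `τ` is held fixed while `σ` is multiplied by them.
  rw [← Equiv.sum_comp (Equiv.mulLeft (s τ))]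
  refine Finset.sum_congr rfl fun σ _ => ?_
  congr 1
  have h1 := hbw (E (s τ * σ, τ)) (s τ * σ) τ (fun d => by rw [hE, heV]; rfl)
    (fun d => by rw [hE, heF]; rfl)
  have h2 := hat σ τ
  suffices h : 2 * -M.hamiltonianHMBW J (E (s τ * σ, τ)) =
      2 * -(M.bichromatic c i k).hamiltonianMixedAT J 0 J σ τ from
    mul_left_cancel₀ two_ne_zero h
  rw [h1, h2]
  congr 1
  refine Finset.sum_congr rfl fun d _ => ?_
  rw [← hs τ d]
  simp only [Pi.mul_apply]
  push_cast
  ring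

end Tricoloured

end CombMap

/-- The colours `0, 1, 2` stand for the classes `V₁, V₂, V₃`. The case `i = 0, j = 1` is the
statement for `G₁₃` with dual on `V₂`; the case `i = 1, j = 0` is the one for `G₂₃` with dual on
`V₁`. The vertex of the face of a dart `d` that is not on `d` is the tail of
`facePerm (facePerm d)`. -/
theorem theorem4p6 {D : Type*} [Fintype D] (M : CombMap D) (hplane : M.IsPlane)
    (htri : M.IsTriangulation) (heuler : M.IsEulerian)
    (c : M.Vertex → Fin 3) (hc : M.IsProperColoring c)
    (hdeg : ∀ v, c v = 2 → M.degree v = 4 ∨ M.degree v = 6)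
    (i j : Fin 3) (hij : (i = 0 ∧ j = 1) ∨ (i = 1 ∧ j = 0)) :
    (M.bichromatic c i 2).IsPlane ∧
    (∃ eV : (M.bichromatic c i 2).Vertex ≃ {v : M.Vertex // c v = i ∨ c v = 2},
      ∀ d, (eV ((M.bichromatic c i 2).vert d) : M.Vertex) = M.vert d) ∧
    (∃ eF : (M.bichromatic c i 2).dual.Vertex ≃ {v : M.Vertex // c v = j},
      ∀ d, (eF ((M.bichromatic c i 2).dual.vert d) : M.Vertex) =
        M.vert (M.facePerm (M.facePerm d))) ∧
    ∀ J : ℝ, M.partitionHMBW J = (M.bichromatic c i 2).partitionMixedAT J 0 J := by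
  have hij' : i ≠ j ∧ i ≠ 2 ∧ j ≠ 2 := by
    rcases hij with ⟨rfl, rfl⟩ | ⟨rfl, rfl⟩ <;> decide
  obtain ⟨h1, h2, h3⟩ := hij'
  exact ⟨htri.bichromatic_isPlane hplane hc h1 h2 h3, htri.exists_vertexEquiv hc h1 h2 h3,
    htri.exists_dualVertexEquiv hc h1 h2 h3,
    htri.partitionHMBW_eq_partitionMixedAT hc h1 h2 h3 hdeg⟩
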